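/- Let $a,b$ be integers with $2\le a<b$, and let $\mathfrak F_{a,b}$ be the tree containing a vertex $o$ with $a+1$ neighbours $g_0,\dots,g_a$ such that $g_0$ and every vertex whose geodesic from $o$ passes through $g_0$ have valence $b+1$, while every vertex whose geodesic from $o$ passes through one of $g_1,\dots,g_a$ (these neighbours included) has valence $a+1$. Equip $\mathfrak F_{a,b}$ with its graph distance $d$ and its set of vertices with the counting measure, write $|E|$ for the number of elements of $E$, and let $B_r(x)=\{y: d(x,y)\le r\}$ for a vertex $x$ and $r\in\mathbb N=\{0,1,2,\dots\}$. For a complex-valued function $f$ on the vertices define the centred and uncentred Hardy--Littlewood maximal functions $$\mathcal M f(x)=\sup_{r\in\mathbb N}\frac1{|B_r(x)|}\sum_{y\in B_r(x)}|f(y)|,\qquad \mathcal N f(x)=\sup_{B\ni x}\frac1{|B|}\sum_{y\in B}|f(y)|,$$ where the second supremum is over all balls $B=B_r(z)$ ($z$ a vertex, $r\in\mathbb N$) that contain $x$. Then: (i) $\mathcal N$ is unbounded on $L^p(\mathfrak F_{a,b})$ for every $p\in[1,\infty)$, i.e. there is no constant $C<\infty$ with $\|\mathcal N f\|_p\le C\|f\|_p$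 for all $f\in L^p(\mathfrak F_{a,b})$; (ii) $\mathcal M$ is bounded on $L^p(\mathfrak F_{a,b})$ for every $p\in(1,\infty)$, and it is of weak type $(1,1)$, i.e. there is a constant $C<\infty$ such that $\lambda\,|\{x:\mathcal M f(x)>\lambda\}|\le C\|f\|_1$ for all $f\in L^1(\mathfrak F_{a,b})$ and all $\lambda>0$. -/

import Mathlib

open MeasureTheory
open scoped ENNReal NNReal

section GraphMaximal

variable {V : Type*}

/-- The closed ball `B_r(x)` for the graph distance. -/
def SimpleGraph.distClosedBall (G : SimpleGraph V) (x : V) (r : ℕ) : Set V :=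
  {y | G.dist x y ≤ r}

variable [MeasurableSpace V]

/-- The average of `|f|` over `B_r(x)` with respect to the counting measure. -/
noncomputable def ballAverage (G : SimpleGraph V) (f : V → ℂ) (x : V) (r : ℕ) : ℝ≥0∞ :=
  (∫⁻ y in G.distClosedBall x r, ‖f y‖ₑ ∂Measure.count) / Measure.count (G.distClosedBall x r)

/-- The centred Hardy--Littlewood maximal function. -/
noncomputable def centredMaximal (G : SimpleGraph V) (f : V → ℂ) (x : V) : ℝ≥0∞ :=
  ⨆ r : ℕ, ballAverage G f x r

/-- The uncentred Hardy--Littlewood maximal function: the supremum is over all balls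
`B_r(z)` that contain `x`. -/
noncomputable def uncentredMaximal (G : SimpleGraph V) (f : V → ℂ) (x : V) : ℝ≥0∞ :=
  ⨆ (z : V) (r : ℕ) (_ : x ∈ G.distClosedBall z r), ballAverage G f z r

/-- The operator `T` is bounded on `L^p` of the counting measure. -/
def BoundedOnLp (T : (V → ℂ) → V → ℝ≥0∞) (p : ℝ≥0∞) : Prop :=
  ∃ C : ℝ≥0, ∀ f : V → ℂ, MemLp f p Measure.count →
    eLpNorm (T f) p Measure.count ≤ C * eLpNorm f p Measure.count

/-- The operator `T` is of weak type `(1,1)` for the counting measure. -/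
def WeakTypeOneOne (T : (V → ℂ) → V → ℝ≥0∞) : Prop :=
  ∃ C : ℝ≥0, ∀ f : V → ℂ, MemLp f 1 Measure.count → ∀ l : ℝ≥0, 0 < l →
    (l : ℝ≥0∞) * Measure.count {x | (l : ℝ≥0∞) < T f x} ≤ C * eLpNorm f 1 Measure.count

end GraphMaximal

namespace GluedTree

/-- A vertex is coded by the word that describes the geodesic from the root `o = []` to it, the
last step being the head of the list; the neighbours of the root are `[0], …, [a]`. The number of
neighbours of a vertex that are farther from the root is `a + 1` at the root, `b` at the vertices
whose geodesic from the root starts with the step to `[0]`, and `a` at all others. -/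
def numChildren (a b : ℕ) (w : List ℕ) : ℕ :=
  if w = [] then a + 1 else if w.getLast? = some 0 then b else a

/-- The words that code a vertex. -/
def IsVertex (a b : ℕ) : List ℕ → Prop
  | [] => True
  | c :: w => c < numChildren a b w ∧ IsVertex a b w

/-- The vertices of the tree `F_{a,b}`. -/
@[ext]
structure Vertex (a b : ℕ) where
  /-- The word that codes the vertex. -/
  word : List ℕ
  isVertex : IsVertex a b word

instance (a b : ℕ) : MeasurableSpace (Vertex a b) := ⊤

instance (a b : ℕ) : DiscreteMeasurableSpace (Vertex a b) := ⟨fun _ => trivial⟩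

/-- The tree `F_{a,b}`: the edges join each vertex to its children. -/
def graph (a b : ℕ) : SimpleGraph (Vertex a b) where
  Adj x y := (∃ c, y.word = c :: x.word) ∨ (∃ c, x.word = c :: y.word)
  symm := ⟨fun _ _ h => h.symm⟩
  loopless := ⟨fun x h => by rcases h with ⟨c, h⟩ | ⟨c, h⟩ <;> simpa using congrArg List.length h⟩

theorem connected_graph (a b : ℕ) : (graph a b).Connected := by
  have key : ∀ (w : List ℕ) (h : IsVertex a b w),
      (graph a b).Reachable ⟨[], trivial⟩ ⟨w, h⟩ := by
    intro w
    induction w with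
    | nil => intro h; exact SimpleGraph.Reachable.refl _
    | cons c w ih =>
      intro h
      refine (ih h.2).trans (SimpleGraph.Adj.reachable ?_)
      exact Or.inl ⟨c, rfl⟩
  have : Nonempty (Vertex a b) := ⟨⟨[], trivial⟩⟩
  exact ⟨fun x y => (key x.word x.isVertex).symm.trans (key y.word y.isVertex)⟩

theorem isTree_graph (a b : ℕ) : (graph a b).IsTree := by
  refine ⟨connected_graph a b, ?_⟩
  rw [SimpleGraph.isAcyclic_iff_forall_adj_isBridge]
  have key : ∀ x y : Vertex a b, (∃ c, y.word = c :: x.word) → (graph a b).IsBridge s(x, y) := by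
    rintro x y ⟨c, hc⟩
    rw [SimpleGraph.isBridge_iff]
    have inv : ∀ u v : Vertex a b, ((graph a b) \ SimpleGraph.fromEdgeSet {s(x, y)}).Walk u v →
        y.word <:+ v.word → y.word <:+ u.word := by
      intro u v p
      induction p with
      | nil => exact id
      | @cons u v w h p ih =>
        intro hw
        have hv := ih hw
        rw [SimpleGraph.sdiff_adj] at h
        obtain ⟨⟨d, hd⟩ | ⟨d, hd⟩, hn⟩ := h
        · rw [hd, List.suffix_cons_iff] at hv
          rcases hv with hv | hv
          · exfalso
            rw [hc] at hv
            have h1 : v = y := Vertex.ext (by rw [hd, hc, hv])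
            have h2 : u = x := Vertex.ext (List.cons.inj hv).2.symm
            apply hn
            subst h1 h2
            rw [SimpleGraph.fromEdgeSet_adj]
            refine ⟨rfl, fun e => ?_⟩
            have := congrArg (fun z : Vertex a b => z.word.length) e
            simp [hc] at this
          · exact hv
        · rw [hd]
          exact hv.trans (List.suffix_cons _ _)
    rintro ⟨p⟩
    have := (inv x y p List.suffix_rfl).length_le
    rw [hc] at this
    simp at this
  intro x y h
  rcases h with h | h
  · exact key x y h
  · rw [Sym2.eq_swap]
    exact key y x h

/-- The valence is `a + 1` at the root, `b + 1` on the branch through `[0]`, and `a + 1` at all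
other vertices. -/
theorem ncard_neighborSet_graph (a b : ℕ) (x : Vertex a b) :
    ((graph a b).neighborSet x).ncard =
      if x.word = [] then a + 1 else if x.word.getLast? = some 0 then b + 1 else a + 1 := by
  let child : Fin (numChildren a b x.word) → Vertex a b := fun c => ⟨c.1 :: x.word, c.2, x.isVertex⟩
  have hinj : Function.Injective child := fun c d h =>
    Fin.ext (List.cons.inj (congrArg Vertex.word h)).1
  have hcard : (Set.range child).ncard = numChildren a b x.word := by
    rw [Set.ncard_range_of_injective hinj, Nat.card_fin]
  have hmem : ∀ y : Vertex a b, (∃ c, y.word = c :: x.word) ↔ y ∈ Set.range child := by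
    intro y
    constructor
    · rintro ⟨c, hc⟩
      have hy := y.isVertex
      rw [hc] at hy
      exact ⟨⟨c, hy.1⟩, Vertex.ext hc.symm⟩
    · rintro ⟨c, rfl⟩
      exact ⟨c.1, rfl⟩
  have hadj : ∀ y : Vertex a b, y ∈ (graph a b).neighborSet x ↔
      (∃ c, y.word = c :: x.word) ∨ (∃ c, x.word = c :: y.word) := fun _ => Iff.rfl
  have hx := x.isVertex
  cases hw : x.word with
  | nil =>
    have : (graph a b).neighborSet x = Set.range child := by
      ext y
      rw [← hmem y, hadj y, hw]
      simp
    rw [this, hcard, hw]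
    simp [numChildren]
  | cons d w =>
    rw [hw] at hx
    have : (graph a b).neighborSet x = insert ⟨w, hx.2⟩ (Set.range child) := by
      ext y
      rw [Set.mem_insert_iff, ← hmem y, hadj y, or_comm]
      refine or_congr ⟨?_, ?_⟩ Iff.rfl
      · rintro ⟨c, hc⟩
        rw [hw] at hc
        exact Vertex.ext (List.cons.inj hc).2.symm
      · rintro rfl
        exact ⟨d, hw⟩
    rw [this, Set.ncard_insert_of_notMem _ (Set.finite_range child), hcard, hw]
    · simp only [numChildren, reduceCtorEq, if_false]
      split_ifs <;> rfl
    · rw [← hmem, hw]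
      rintro ⟨c, hc⟩
      have := congrArg List.length hc
      simp at this
      omega

end GluedTree

namespace GluedTree

variable {a b : ℕ}

instance : Countable (Vertex a b) :=
  Function.Injective.countable (f := Vertex.word) fun _ _ h => Vertex.ext h

/-- The root of the tree. -/
def root (a b : ℕ) : Vertex a b := ⟨[], trivial⟩

theorem IsVertex.of_append {u w : List ℕ} (h : IsVertex a b (u ++ w)) : IsVertex a b w := by
  induction u with
  | nil => exact h
  | cons c u ih => exact ih h.2

/-- `x` is a descendant of `z`, by `i` generations. -/
def Desc (i : ℕ) (z x : Vertex a b) : Prop := ∃ u : List ℕ, u.length = i ∧ x.word = u ++ z.word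

theorem desc_zero {z x : Vertex a b} : Desc 0 z x ↔ x = z := by
  constructor
  · rintro ⟨u, hu, hx⟩
    rw [List.length_eq_zero_iff] at hu
    subst hu
    exact Vertex.ext hx
  · rintro rfl
    exact ⟨[], rfl, rfl⟩

theorem desc_one {z x : Vertex a b} : Desc 1 z x ↔ ∃ c, x.word = c :: z.word := by
  constructor
  · rintro ⟨u, hu, hx⟩
    obtain ⟨c, rfl⟩ := List.length_eq_one_iff.1 hu
    exact ⟨c, hx⟩
  · rintro ⟨c, hc⟩
    exact ⟨[c], rfl, hc⟩

theorem desc_add {i j : ℕ} {z x : Vertex a b} :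
    Desc (i + j) z x ↔ ∃ w, Desc i z w ∧ Desc j w x := by
  constructor
  · rintro ⟨u, hu, hx⟩
    have hv := x.isVertex
    rw [hx, ← List.take_append_drop j u, List.append_assoc] at hv
    refine ⟨⟨u.drop j ++ z.word, hv.of_append⟩, ⟨u.drop j, by simp [hu], rfl⟩,
      ⟨u.take j, by simp [hu], ?_⟩⟩
    rw [hx, ← List.append_assoc, List.take_append_drop]
  · rintro ⟨w, ⟨u, hu, hw⟩, ⟨v, hv, hx⟩⟩
    exact ⟨v ++ u, by simp [hu, hv, add_comm], by rw [hx, hw, List.append_assoc]⟩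

theorem Desc.length_word {i : ℕ} {z x : Vertex a b} (h : Desc i z x) :
    x.word.length = i + z.word.length := by
  obtain ⟨u, rfl, hx⟩ := h
  simp [hx]

theorem Desc.unique {i : ℕ} {z z' x : Vertex a b} (h : Desc i z x) (h' : Desc i z' x) : z = z' := by
  obtain ⟨u, hu, hx⟩ := h
  obtain ⟨v, hv, hx'⟩ := h'
  exact Vertex.ext (List.append_inj (hx.symm.trans hx') (hu.trans hv.symm)).2

theorem desc_root (x : Vertex a b) : Desc x.word.length (root a b) x :=
  ⟨x.word, rfl, by simp [root]⟩

theorem Desc.dist_le {i : ℕ} {z x : Vertex a b} (h : Desc i z x) : (graph a b).dist z x ≤ i := by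
  induction i generalizing x with
  | zero => rw [desc_zero.1 h]; simp
  | succ i ih =>
    obtain ⟨w, hw, hx⟩ := desc_add.1 h
    have hadj : (graph a b).Adj w x := Or.inl (desc_one.1 hx)
    calc (graph a b).dist z x ≤ (graph a b).dist z w + (graph a b).dist w x :=
          (connected_graph a b).dist_triangle
      _ ≤ i + 1 := add_le_add (ih hw) (SimpleGraph.dist_eq_one_iff_adj.2 hadj).le

theorem exists_common_ancestor_of_walk {x y : Vertex a b} (p : (graph a b).Walk x y) :
    ∃ i j z, i + j ≤ p.length ∧ Desc i z x ∧ Desc j z y := by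
  induction p with
  | @nil x => exact ⟨0, 0, x, le_rfl, desc_zero.2 rfl, desc_zero.2 rfl⟩
  | @cons x x' y h p ih =>
    obtain ⟨i, j, z, hij, hi, hj⟩ := ih
    rw [SimpleGraph.Walk.length_cons]
    rcases h with h | h
    · rw [← desc_one] at h
      rcases i with _ | i
      · rw [desc_zero] at hi
        subst hi
        exact ⟨0, 1 + j, x, by omega, desc_zero.2 rfl, desc_add.2 ⟨_, h, hj⟩⟩
      · obtain ⟨w, hw, hw'⟩ := desc_add.1 hi
        rw [h.unique hw']
        exact ⟨i, j, z, by omega, hw, hj⟩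
    · rw [← desc_one] at h
      exact ⟨i + 1, j, z, by omega, desc_add.2 ⟨_, hi, h⟩, hj⟩

theorem exists_common_ancestor {x y : Vertex a b} {r : ℕ}
    (h : y ∈ (graph a b).distClosedBall x r) :
    ∃ i j z, i + j ≤ r ∧ Desc i z x ∧ Desc j z y := by
  obtain ⟨p, hp⟩ := (connected_graph a b).exists_walk_length_eq_dist x y
  obtain ⟨i, j, z, hij, hi, hj⟩ := exists_common_ancestor_of_walk p
  exact ⟨i, j, z, (hij.trans hp.le).trans h, hi, hj⟩

theorem count_biUnion_children (R S : Set (Vertex a b)) :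
    Measure.count (⋃ w ∈ S, {x ∈ R | Desc 1 w x}) =
      ∑' w : S, Measure.count {x ∈ R | Desc 1 (w : Vertex a b) x} := by
  rw [measure_biUnion (Set.to_countable _) ?_ (fun _ _ => .of_discrete)]
  intro w _ w' _ hne
  rw [Function.onFun, Set.disjoint_left]
  rintro x ⟨-, h⟩ ⟨-, h'⟩
  exact hne (h.unique h')

theorem tsum_const_eq_count {α : Type*} [MeasurableSpace α] [DiscreteMeasurableSpace α]
    (s : Set α) (c : ℝ≥0∞) : ∑' _ : s, c = c * Measure.count s := by
  rw [ENNReal.tsum_const, mul_comm, Measure.count_apply (.of_discrete)]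
  rfl

theorem count_setOf_desc_le {R : Set (Vertex a b)} (hR : ∀ w x, Desc 1 w x → x ∈ R → w ∈ R)
    {q : ℝ≥0∞} (hq : ∀ w ∈ R, Measure.count {x ∈ R | Desc 1 w x} ≤ q) (i : ℕ) (z : Vertex a b) :
    Measure.count {x ∈ R | Desc i z x} ≤ q ^ i := by
  induction i with
  | zero =>
    refine (measure_mono (t := {z}) fun x hx => desc_zero.1 hx.2).trans ?_
    simp
  | succ i ih =>
    have hsub : {x ∈ R | Desc (i + 1) z x} ⊆ ⋃ w ∈ {w ∈ R | Desc i z w}, {x ∈ R | Desc 1 w x} := by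
      rintro x ⟨hx, h⟩
      obtain ⟨w, hw, hwx⟩ := desc_add.1 h
      exact Set.mem_biUnion (x := w) ⟨hR w x hwx hx, hw⟩ ⟨hx, hwx⟩
    rw [pow_succ']
    refine (measure_mono hsub).trans ?_
    rw [count_biUnion_children]
    calc _ ≤ ∑' _ : {w ∈ R | Desc i z w}, q := ENNReal.tsum_le_tsum fun w => hq w w.2.1
      _ ≤ q * q ^ i := by rw [tsum_const_eq_count]; gcongr

theorem le_count_setOf_desc {R : Set (Vertex a b)} {q : ℝ≥0∞} (hq : ∀ w ∈ R, q ≤ Measure.count {x ∈ R | Desc 1 w x}) (i : ℕ)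
    {z : Vertex a b} (hz : z ∈ R) : q ^ i ≤ Measure.count {x ∈ R | Desc i z x} := by
  induction i with
  | zero =>
    refine le_trans ?_ (measure_mono (s := {z}) fun x hx => ?_)
    · simp
    · rw [Set.mem_singleton_iff.1 hx]
      exact ⟨hz, desc_zero.2 rfl⟩
  | succ i ih =>
    have hsub : (⋃ w ∈ {w ∈ R | Desc i z w}, {x ∈ R | Desc 1 w x}) ⊆ {x ∈ R | Desc (i + 1) z x} :=
      Set.iUnion₂_subset fun w hw x hx => ⟨hx.1, desc_add.2 ⟨w, hw.2, hx.2⟩⟩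
    rw [pow_succ']
    refine le_trans ?_ (measure_mono hsub)
    rw [count_biUnion_children]
    calc q * q ^ i ≤ ∑' _ : {w ∈ R | Desc i z w}, q := by rw [tsum_const_eq_count]; gcongr
      _ ≤ _ := ENNReal.tsum_le_tsum fun w => hq w w.2.1

/-- The vertices whose geodesic from the root does not go through `[0]`. -/
def thinPart (a b : ℕ) : Set (Vertex a b) := {x | x.word.getLast? ≠ some 0}

/-- The vertices whose geodesic from the root goes through `[0]`. -/
def thickPart (a b : ℕ) : Set (Vertex a b) := {x | x.word.getLast? = some 0}

theorem count_children (P : List ℕ → Prop) (w : Vertex a b) (S : Finset ℕ)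
    (hS : ∀ c, c ∈ S ↔ c < numChildren a b w.word ∧ P (c :: w.word)) :
    Measure.count {x : Vertex a b | P x.word ∧ Desc 1 w x} = S.card := by
  let child : S → Vertex a b := fun c => ⟨c.1 :: w.word, ((hS c).1 c.2).1, w.isVertex⟩
  have hinj : Function.Injective child := fun c d h =>
    Subtype.ext (List.cons.inj (congrArg Vertex.word h)).1
  have : {x : Vertex a b | P x.word ∧ Desc 1 w x} = Set.range child := by
    ext x
    constructor
    · rintro ⟨hP, hx⟩
      obtain ⟨c, hc⟩ := desc_one.1 hx
      have hv := x.isVertex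
      rw [hc] at hv hP
      exact ⟨⟨c, (hS c).2 ⟨hv.1, hP⟩⟩, Vertex.ext hc.symm⟩
    · rintro ⟨c, rfl⟩
      exact ⟨((hS c).1 c.2).2, desc_one.2 ⟨c, rfl⟩⟩
  rw [this, Measure.count_apply .of_discrete, ← Set.image_univ, hinj.encard_image]
  simp

theorem count_children_thinPart {w : Vertex a b} (hw : w ∈ thinPart a b) :
    Measure.count {x ∈ thinPart a b | Desc 1 w x} = a := by
  have hw' : w.word.getLast? ≠ some 0 := hw
  by_cases h : w.word = []
  · refine (count_children (fun l => l.getLast? ≠ some 0) w ((Finset.range (a + 1)).erase 0)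
      fun c => ?_).trans (by simp)
    simp [numChildren, h, and_comm]
  · refine (count_children (fun l => l.getLast? ≠ some 0) w (Finset.range a)
      fun c => ?_).trans (by simp)
    simp [numChildren, h, hw', List.getLast?_cons_of_ne_nil h]

theorem count_children_thickPart {w : Vertex a b} (hw : w ∈ thickPart a b) :
    Measure.count {x ∈ thickPart a b | Desc 1 w x} = b := by
  have hw' : w.word.getLast? = some 0 := hw
  have h : w.word ≠ [] := by
    intro h
    simp [h] at hw'
  refine (count_children (fun l => l.getLast? = some 0) w (Finset.range b)
    fun c => ?_).trans (by simp)
  simp [numChildren, h, hw', List.getLast?_cons_of_ne_nil h]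

theorem mem_thickPart_of_desc {i : ℕ} {z x : Vertex a b} (hx : x ∈ thickPart a b)
    (h : Desc i z x) (hz : z ≠ root a b) : z ∈ thickPart a b := by
  obtain ⟨u, -, hu⟩ := h
  have hne : z.word ≠ [] := fun e => hz (Vertex.ext e)
  have hx' : x.word.getLast? = some 0 := hx
  rw [hu, List.getLast?_append_of_ne_nil _ hne] at hx'
  exact hx'

theorem mem_thinPart_of_desc {i : ℕ} {z x : Vertex a b} (hx : x ∈ thinPart a b)
    (h : Desc i z x) : z ∈ thinPart a b := by
  intro hz
  obtain ⟨u, -, hu⟩ := h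
  have hne : z.word ≠ [] := by
    intro h
    simp [h] at hz
  apply hx
  rw [hu, List.getLast?_append_of_ne_nil _ hne, hz]

theorem count_thinPart_desc_le (i : ℕ) (z : Vertex a b) :
    Measure.count {x ∈ thinPart a b | Desc i z x} ≤ (a : ℝ≥0∞) ^ i :=
  count_setOf_desc_le (fun _ _ h hx => mem_thinPart_of_desc hx h)
    (fun _ hw => (count_children_thinPart hw).le) i z

theorem le_count_thinPart_desc (i : ℕ) {z : Vertex a b} (hz : z ∈ thinPart a b) :
    (a : ℝ≥0∞) ^ i ≤ Measure.count {x ∈ thinPart a b | Desc i z x} :=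
  le_count_setOf_desc (fun _ hw => (count_children_thinPart hw).ge) i hz

theorem le_count_thickPart_desc (i : ℕ) {z : Vertex a b} (hz : z ∈ thickPart a b) :
    (b : ℝ≥0∞) ^ i ≤ Measure.count {x ∈ thickPart a b | Desc i z x} :=
  le_count_setOf_desc (fun _ hw => (count_children_thickPart hw).ge) i hz

theorem count_thickPart_desc_le (hb : 1 ≤ b) (i : ℕ) (z : Vertex a b) :
    Measure.count {x ∈ thickPart a b | Desc i z x} ≤ (b : ℝ≥0∞) ^ i := by
  let R : Set (Vertex a b) := insert (root a b) (thickPart a b)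
  refine (measure_mono (t := {x ∈ R | Desc i z x}) fun x hx => ⟨Or.inr hx.1, hx.2⟩).trans
    (count_setOf_desc_le ?_ ?_ i z)
  · rintro w x h (rfl | hx)
    · exact absurd h.length_word (by simp [root]; omega)
    · by_cases hw : w = root a b
      · exact Or.inl hw
      · exact Or.inr (mem_thickPart_of_desc hx h hw)
  · intro w hw
    have hsub : {x ∈ R | Desc 1 w x} ⊆ {x ∈ thickPart a b | Desc 1 w x} := by
      rintro x ⟨rfl | hx, h⟩
      · exact absurd h.length_word (by simp [root]; omega)
      · exact ⟨hx, h⟩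
    refine (measure_mono hsub).trans ?_
    rcases hw with rfl | hw
    · refine (count_children (fun l => l.getLast? = some 0) _ {0} fun c => ?_).trans_le ?_
      · simp [numChildren, root]
        omega
      · simpa using hb
    · exact (count_children_thickPart hw).le

end GluedTree

namespace GluedTree

variable {a b : ℕ}

/-- The sum of `F` over the descendants of `z` by at most `j` generations. -/
noncomputable def descSum (F : Vertex a b → ℝ≥0∞) (j : ℕ) (z : Vertex a b) : ℝ≥0∞ :=
  ∫⁻ y in {y | ∃ k ≤ j, Desc k z y}, F y ∂Measure.count

theorem count_ancestors_le (j : ℕ) (y : Vertex a b) :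
    Measure.count {z : Vertex a b | ∃ k ≤ j, Desc k z y} ≤ j + 1 := by
  have hsub : {z : Vertex a b | ∃ k ≤ j, Desc k z y} ⊆
      ⋃ k ∈ Finset.range (j + 1), {z | Desc k z y} := by
    rintro z ⟨k, hk, h⟩
    exact Set.mem_biUnion (x := k) (by simpa [Nat.lt_succ_iff] using hk) h
  have hone : ∀ k, Measure.count {z : Vertex a b | Desc k z y} ≤ 1 := by
    intro k
    have : {z : Vertex a b | Desc k z y}.Subsingleton := fun z hz z' hz' => hz.unique hz'
    rw [Measure.count_apply .of_discrete]
    exact_mod_cast Set.encard_le_one_iff_subsingleton.2 this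
  calc _ ≤ ∑ k ∈ Finset.range (j + 1), Measure.count {z : Vertex a b | Desc k z y} :=
        (measure_mono hsub).trans (measure_biUnion_finset_le _ _)
    _ ≤ ∑ k ∈ Finset.range (j + 1), 1 := Finset.sum_le_sum fun k _ => hone k
    _ = j + 1 := by simp

theorem tsum_descSum_le (F : Vertex a b → ℝ≥0∞) (j : ℕ) :
    ∑' z, descSum F j z ≤ (j + 1) * ∑' y, F y := by
  classical
  have h : ∀ z, descSum F j z = ∑' y, if ∃ k ≤ j, Desc k z y then F y else 0 := by
    intro z
    rw [descSum, ← lintegral_indicator .of_discrete, lintegral_count]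
    simp only [Set.indicator_apply, Set.mem_ofPred_eq]
  simp_rw [h]
  rw [ENNReal.tsum_comm, ← ENNReal.tsum_mul_left]
  refine ENNReal.tsum_le_tsum fun y => ?_
  calc (∑' z, if ∃ k ≤ j, Desc k z y then F y else 0)
      = ∫⁻ z, {z | ∃ k ≤ j, Desc k z y}.indicator (fun _ => F y) z ∂Measure.count := by
        rw [lintegral_count]
        simp only [Set.indicator_apply, Set.mem_ofPred_eq]
    _ = F y * Measure.count {z : Vertex a b | ∃ k ≤ j, Desc k z y} :=
        lintegral_indicator_const .of_discrete _
    _ ≤ (j + 1) * F y := by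
        rw [mul_comm]
        gcongr
        exact count_ancestors_le j y

theorem sum_range_pow_le {q : ℕ} (hq : 2 ≤ q) (n : ℕ) :
    ∑ i ∈ Finset.range (n + 1), (q : ℝ≥0∞) ^ i ≤ 2 * (q : ℝ≥0∞) ^ n := by
  have : ∑ i ∈ Finset.range (n + 1), q ^ i ≤ 2 * q ^ n := by
    induction n with
    | zero => simp
    | succ n ih =>
      rw [Finset.sum_range_succ, pow_succ]
      nlinarith [Nat.mul_le_mul_left (q ^ n) hq]
  exact_mod_cast this

theorem tsum_pow_ite_lt_le {q : ℕ} (hq : 2 ≤ q) (T : ℝ≥0∞) :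
    (∑' i : ℕ, if (q : ℝ≥0∞) ^ i < T then (q : ℝ≥0∞) ^ i else 0) ≤ 2 * T := by
  refine ENNReal.tsum_le_of_sum_range_le fun n => ?_
  induction n with
  | zero => simp
  | succ n ih =>
    by_cases h : (q : ℝ≥0∞) ^ n < T
    · calc _ ≤ ∑ i ∈ Finset.range (n + 1), (q : ℝ≥0∞) ^ i :=
            Finset.sum_le_sum fun i _ => by split_ifs <;> simp
        _ ≤ 2 * (q : ℝ≥0∞) ^ n := sum_range_pow_le hq n
        _ ≤ 2 * T := by gcongr
    · rw [Finset.sum_range_succ, if_neg h, add_zero]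
      exact ih

theorem lintegral_biUnion_finset_le {ι α : Type*} [MeasurableSpace α] (μ : Measure α)
    (s : Finset ι) (t : ι → Set α) (F : α → ℝ≥0∞) :
    ∫⁻ y in ⋃ i ∈ s, t i, F y ∂μ ≤ ∑ i ∈ s, ∫⁻ y in t i, F y ∂μ := by
  classical
  induction s using Finset.induction_on with
  | empty => simp
  | insert i s hi ih =>
    rw [Finset.set_biUnion_insert, Finset.sum_insert hi]
    exact (lintegral_union_le _ _ _).trans (by gcongr)

theorem lintegral_ball_le (F : Vertex a b → ℝ≥0∞) (x : Vertex a b) (r : ℕ) {g : ℕ → ℝ≥0∞}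
    (hg : ∀ i ≤ r, ∀ z, Desc i z x → descSum F (r - i) z ≤ g i) :
    ∫⁻ y in (graph a b).distClosedBall x r, F y ∂Measure.count ≤
      ∑ i ∈ Finset.range (r + 1), g i := by
  have hsub : (graph a b).distClosedBall x r ⊆ ⋃ i ∈ Finset.range (r + 1),
      {y | ∃ z, Desc i z x ∧ ∃ k ≤ r - i, Desc k z y} := by
    intro y hy
    obtain ⟨i, j, z, hij, hi, hj⟩ := exists_common_ancestor hy
    exact Set.mem_biUnion (x := i) (by simp; omega) ⟨z, hi, j, by omega, hj⟩
  refine (lintegral_mono_set hsub).trans ((lintegral_biUnion_finset_le _ _ _ _).trans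
    (Finset.sum_le_sum fun i hi => ?_))
  by_cases h : ∃ z, Desc i z x
  · obtain ⟨z, hz⟩ := h
    refine (lintegral_mono_set ?_).trans (hg i (by simpa [Nat.lt_succ_iff] using hi) z hz)
    rintro y ⟨z', hz', h⟩
    rwa [hz.unique hz']
  · have : {y : Vertex a b | ∃ z, Desc i z x ∧ ∃ k ≤ r - i, Desc k z y} = ∅ :=
      Set.eq_empty_of_forall_notMem fun y ⟨z, hz, _⟩ => h ⟨z, hz⟩
    simp [this]

theorem exists_lt_descSum {q : ℕ} {w : ℕ → ℝ≥0∞} (hw : ∑' j, w j ≤ 1)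
    {f : Vertex a b → ℂ} {x : Vertex a b}
    (hx : ∀ r, (q : ℝ≥0∞) ^ r ≤ Measure.count ((graph a b).distClosedBall x r))
    {l : ℝ≥0∞} (h : l < centredMaximal (graph a b) f x) :
    ∃ j z i, l * ((q : ℝ≥0∞) ^ (i + j) * w j) < descSum (‖f ·‖ₑ) j z ∧ Desc i z x := by
  by_contra! hcon
  obtain ⟨r, hr⟩ := lt_iSup_iff.1 h
  refine hr.not_ge (ENNReal.div_le_of_le_mul ?_)
  calc _ ≤ ∑ i ∈ Finset.range (r + 1), l * ((q : ℝ≥0∞) ^ r * w (r - i)) := by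
        refine lintegral_ball_le _ x r fun i hi z hz => ?_
        by_contra! hlt
        refine hcon (r - i) z i ?_ hz
        rwa [Nat.add_sub_cancel' hi]
    _ = l * ((q : ℝ≥0∞) ^ r * ∑ j ∈ Finset.range (r + 1), w j) := by
        rw [← Finset.mul_sum, ← Finset.mul_sum, ← Finset.sum_range_reflect w]
        simp
    _ ≤ l * ((q : ℝ≥0∞) ^ r * 1) := by
        gcongr
        exact (ENNReal.sum_le_tsum _).trans hw
    _ ≤ _ := by
        rw [mul_one]
        gcongr
        exact hx r

theorem count_lt_centredMaximal_le {q : ℕ} (hq : 2 ≤ q) {w : ℕ → ℝ≥0∞} (hw : ∑' j, w j ≤ 1)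
    (hw0 : ∀ j, w j ≠ 0) {R : Set (Vertex a b)}
    (hup : ∀ i z, Measure.count {x ∈ R | Desc i z x} ≤ (q : ℝ≥0∞) ^ i)
    (hlow : ∀ x ∈ R, ∀ r, (q : ℝ≥0∞) ^ r ≤ Measure.count ((graph a b).distClosedBall x r))
    (f : Vertex a b → ℂ) {l : ℝ≥0∞} (hl : l ≠ 0) (hl' : l ≠ ∞) :
    l * Measure.count {x ∈ R | l < centredMaximal (graph a b) f x} ≤
      (∑' j : ℕ, 2 * (j + 1) * ((q : ℝ≥0∞) ^ j * w j)⁻¹) * ∑' y, ‖f y‖ₑ := by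
  classical
  have hwt : ∀ j, w j ≠ ∞ := fun j =>
    ((ENNReal.le_tsum j).trans hw).trans_lt ENNReal.one_lt_top |>.ne
  have hq0 : (q : ℝ≥0∞) ≠ 0 := by simp; omega
  have hv0 : ∀ j, (q : ℝ≥0∞) ^ j * w j ≠ 0 := fun j => mul_ne_zero (pow_ne_zero _ hq0) (hw0 j)
  have hvt : ∀ j, (q : ℝ≥0∞) ^ j * w j ≠ ∞ := fun j =>
    ENNReal.mul_ne_top (ENNReal.pow_ne_top (by simp)) (hwt j)
  have hsub : {x ∈ R | l < centredMaximal (graph a b) f x} ⊆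
      ⋃ (j) (z) (i) (_ : l * ((q : ℝ≥0∞) ^ (i + j) * w j) < descSum (‖f ·‖ₑ) j z),
        {x ∈ R | Desc i z x} := by
    rintro x ⟨hxR, hx⟩
    obtain ⟨j, z, i, h, hd⟩ := exists_lt_descSum hw (hlow x hxR) hx
    simp only [Set.mem_iUnion]
    exact ⟨j, z, i, h, hxR, hd⟩
  have hinner : ∀ j z i,
      Measure.count (⋃ (_ : l * ((q : ℝ≥0∞) ^ (i + j) * w j) < descSum (‖f ·‖ₑ) j z),
        {x ∈ R | Desc i z x}) ≤
      if (q : ℝ≥0∞) ^ i < descSum (‖f ·‖ₑ) j z / (l * ((q : ℝ≥0∞) ^ j * w j))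
        then (q : ℝ≥0∞) ^ i else 0 := by
    intro j z i
    by_cases h : l * ((q : ℝ≥0∞) ^ (i + j) * w j) < descSum (‖f ·‖ₑ) j z
    · rw [if_pos]
      · simpa [h] using hup i z
      · rw [ENNReal.lt_div_iff_mul_lt (Or.inl (mul_ne_zero hl (hv0 j)))
          (Or.inl (ENNReal.mul_ne_top hl' (hvt j)))]
        convert h using 1
        ring
    · simp [h]
  calc l * Measure.count {x ∈ R | l < centredMaximal (graph a b) f x}
      ≤ l * ∑' j, ∑' z, ∑' i,
        Measure.count (⋃ (_ : l * ((q : ℝ≥0∞) ^ (i + j) * w j) < descSum (‖f ·‖ₑ) j z),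
        {x ∈ R | Desc i z x}) := by
        gcongr
        refine (measure_mono hsub).trans ((measure_iUnion_le _).trans ?_)
        refine ENNReal.tsum_le_tsum fun j => (measure_iUnion_le _).trans ?_
        exact ENNReal.tsum_le_tsum fun z => measure_iUnion_le _
    _ ≤ l * ∑' j, ∑' z, 2 * (descSum (‖f ·‖ₑ) j z / (l * ((q : ℝ≥0∞) ^ j * w j))) := by
        gcongr with j z
        exact (ENNReal.tsum_le_tsum (hinner j z)).trans (tsum_pow_ite_lt_le hq _)
    _ = ∑' j, 2 * ((l * l⁻¹) * ((q : ℝ≥0∞) ^ j * w j)⁻¹ * ∑' z, descSum (‖f ·‖ₑ) j z) := by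
        rw [← ENNReal.tsum_mul_left]
        refine tsum_congr fun j => ?_
        simp_rw [div_eq_mul_inv, ENNReal.mul_inv (Or.inl hl) (Or.inl hl')]
        rw [ENNReal.tsum_mul_left, ENNReal.tsum_mul_right]
        ring
    _ ≤ ∑' j : ℕ, 2 * (j + 1) * ((q : ℝ≥0∞) ^ j * w j)⁻¹ * ∑' y, ‖f y‖ₑ := by
        refine ENNReal.tsum_le_tsum fun j => ?_
        rw [ENNReal.mul_inv_cancel hl hl', one_mul]
        calc _ ≤ 2 * (((q : ℝ≥0∞) ^ j * w j)⁻¹ * ((j + 1) * ∑' y, ‖f y‖ₑ)) := by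
              gcongr
              exact tsum_descSum_le _ j
          _ = _ := by ring
    _ = _ := ENNReal.tsum_mul_right

theorem exists_count_lt_centredMaximal_le {q : ℕ} (hq : 2 ≤ q) {R : Set (Vertex a b)}
    (hup : ∀ i z, Measure.count {x ∈ R | Desc i z x} ≤ (q : ℝ≥0∞) ^ i)
    (hlow : ∀ x ∈ R, ∀ r, (q : ℝ≥0∞) ^ r ≤ Measure.count ((graph a b).distClosedBall x r)) :
    ∃ C : ℝ≥0, ∀ (f : Vertex a b → ℂ) (l : ℝ≥0), 0 < l →
      l * Measure.count {x ∈ R | (l : ℝ≥0∞) < centredMaximal (graph a b) f x} ≤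
        C * ∑' y, ‖f y‖ₑ := by
  let w : ℕ → ℝ≥0 := fun j => 3⁻¹ * (2 / 3) ^ j
  have hw0 : ∀ j, w j ≠ 0 := fun j => by positivity
  have hw : ∑' j, (w j : ℝ≥0∞) ≤ 1 := by
    have h : HasSum w 1 := by
      have h := (NNReal.hasSum_geometric (r := 2 / 3) (by
        rw [div_lt_one (by norm_num)]; norm_num)).mul_left (3⁻¹ : ℝ≥0)
      have e : (3⁻¹ * (1 - 2 / 3)⁻¹ : ℝ≥0) = 1 := by
        rw [← NNReal.coe_inj, NNReal.coe_mul, NNReal.coe_inv, NNReal.coe_inv, NNReal.coe_sub]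
        · norm_num
        · rw [div_le_one (by norm_num)]; norm_num
      rwa [e] at h
    exact (ENNReal.hasSum_coe.2 h).tsum_eq.le
  let K : ℕ → ℝ≥0 := fun j => 2 * (j + 1) * ((q : ℝ≥0) ^ j * w j)⁻¹
  have hq0 : (q : ℝ≥0) ≠ 0 := by simp; omega
  have hK : Summable K := by
    have h1 : Summable fun j : ℕ => (6 : ℝ) * ((j : ℝ) ^ 1 * (3 / 4) ^ j + (3 / 4) ^ j) :=
      ((summable_pow_mul_geometric_of_norm_lt_one 1 (by norm_num)).add
        (summable_geometric_of_lt_one (by norm_num) (by norm_num))).mul_left 6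
    rw [← NNReal.summable_coe]
    refine Summable.of_nonneg_of_le (fun _ => NNReal.coe_nonneg _) (fun j => ?_) h1
    have hqr : (2 : ℝ) ≤ q := by exact_mod_cast hq
    have h2 : (q : ℝ)⁻¹ ^ j ≤ 2⁻¹ ^ j := by gcongr
    calc (K j : ℝ) = 6 * (j + 1) * ((q : ℝ)⁻¹ ^ j * (3 / 2) ^ j) := by
          simp only [K, w]
          push_cast
          rw [mul_inv, mul_inv, ← inv_pow, ← inv_pow]
          norm_num
          ring
      _ ≤ 6 * (j + 1) * (2⁻¹ ^ j * (3 / 2) ^ j) := by gcongr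
      _ = _ := by
          rw [← mul_pow]
          norm_num
          ring
  refine ⟨∑' j, K j, fun f l hl => ?_⟩
  refine (count_lt_centredMaximal_le hq hw (fun j => by simpa using hw0 j) hup hlow f
    (by simpa using hl.ne') ENNReal.coe_ne_top).trans_eq ?_
  rw [ENNReal.coe_tsum hK]
  congr 2
  funext j
  have hcoe : ((((q : ℝ≥0) ^ j * w j)⁻¹ : ℝ≥0) : ℝ≥0∞) = ((q : ℝ≥0∞) ^ j * w j)⁻¹ := by
    rw [ENNReal.coe_inv (mul_ne_zero (pow_ne_zero _ hq0) (hw0 j)), ENNReal.coe_mul,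
      ENNReal.coe_pow, ENNReal.coe_natCast]
  rw [← hcoe]
  rfl

theorem thinPart_union_thickPart : thinPart a b ∪ thickPart a b = Set.univ :=
  Set.compl_union_self _

theorem exists_mul_count_le (ha : 2 ≤ a) (hb : 2 ≤ b) :
    ∃ C : ℝ≥0, ∀ (f : Vertex a b → ℂ) (l : ℝ≥0), 0 < l →
      l * Measure.count {x | (l : ℝ≥0∞) < centredMaximal (graph a b) f x} ≤
        C * ∑' y, ‖f y‖ₑ := by
  obtain ⟨C, hC⟩ := exists_count_lt_centredMaximal_le (a := a) (b := b) ha count_thinPart_desc_le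
    fun x hx r => (le_count_thinPart_desc r hx).trans (measure_mono fun y hy => hy.2.dist_le)
  obtain ⟨C', hC'⟩ := exists_count_lt_centredMaximal_le (a := a) (b := b) hb
    (count_thickPart_desc_le (by omega))
    fun x hx r => (le_count_thickPart_desc r hx).trans (measure_mono fun y hy => hy.2.dist_le)
  refine ⟨C + C', fun f l hl => ?_⟩
  have hsub : {x | (l : ℝ≥0∞) < centredMaximal (graph a b) f x} ⊆
      {x ∈ thinPart a b | (l : ℝ≥0∞) < centredMaximal (graph a b) f x} ∪
      {x ∈ thickPart a b | (l : ℝ≥0∞) < centredMaximal (graph a b) f x} := by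
    intro x hx
    rcases thinPart_union_thickPart.ge (Set.mem_univ x) with h | h
    · exact Or.inl ⟨h, hx⟩
    · exact Or.inr ⟨h, hx⟩
  calc _ ≤ l * (Measure.count {x ∈ thinPart a b | (l : ℝ≥0∞) < centredMaximal (graph a b) f x} +
        Measure.count {x ∈ thickPart a b | (l : ℝ≥0∞) < centredMaximal (graph a b) f x}) := by
        gcongr
        exact (measure_mono hsub).trans (measure_union_le _ _)
    _ ≤ C * ∑' y, ‖f y‖ₑ + C' * ∑' y, ‖f y‖ₑ := by
        rw [mul_add]
        exact add_le_add (hC f l hl) (hC' f l hl)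
    _ = _ := by rw [ENNReal.coe_add, add_mul]

end GluedTree

section Interpolation

variable {V : Type*} [MeasurableSpace V]

theorem centredMaximal_le_add (G : SimpleGraph V) {f g : V → ℂ} {t : ℝ≥0∞}
    (h : ∀ y, ‖f y‖ₑ ≤ ‖g y‖ₑ + t) (x : V) : centredMaximal G f x ≤ centredMaximal G g x + t := by
  refine iSup_le fun r => ?_
  calc ballAverage G f x r
      ≤ (∫⁻ y in G.distClosedBall x r, (‖g y‖ₑ + t) ∂Measure.count) /
          Measure.count (G.distClosedBall x r) :=
        ENNReal.div_le_div_right (lintegral_mono h) _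
    _ = ballAverage G g x r + t * Measure.count (G.distClosedBall x r) /
          Measure.count (G.distClosedBall x r) := by
        rw [lintegral_add_right _ measurable_const, lintegral_const, Measure.restrict_apply_univ,
          ENNReal.add_div]
        rfl
    _ ≤ centredMaximal G g x + t :=
        add_le_add (le_iSup (ballAverage G g x) r) (ENNReal.div_le_of_le_mul le_rfl)

theorem lintegral_Ioo_rpow {s A : ℝ} (hs : 1 < s) (hA : 0 ≤ A) :
    ∫⁻ t in Set.Ioo 0 A, ENNReal.ofReal (t ^ (s - 2)) = ENNReal.ofReal (A ^ (s - 1) / (s - 1)) := by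
  have hintegral : IntegrableOn (fun t : ℝ => t ^ (s - 2)) (Set.Ioc 0 A) := by
    rw [← intervalIntegrable_iff_integrableOn_Ioc_of_le hA]
    exact intervalIntegral.intervalIntegrable_rpow' (by linarith)
  rw [setLIntegral_congr Ioo_ae_eq_Ioc, ← ofReal_integral_eq_lintegral_ofReal hintegral,
    ← intervalIntegral.integral_of_le hA, integral_rpow (Or.inl (by linarith))]
  · rw [show s - 2 + 1 = s - 1 by ring, Real.zero_rpow (by linarith), sub_zero]
  · filter_upwards [ae_restrict_mem measurableSet_Ioc] with t ht
    exact Real.rpow_nonneg ht.1.le _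

variable {G : SimpleGraph V} {C : ℝ≥0}

theorem count_lt_toReal_centredMaximal_mul_le
    (hC : ∀ (f : V → ℂ) (l : ℝ≥0), 0 < l →
      l * Measure.count {x | (l : ℝ≥0∞) < centredMaximal G f x} ≤ C * ∑' y, ‖f y‖ₑ)
    (f : V → ℂ) (s : ℝ) {t : ℝ} (ht : 0 < t) :
    Measure.count {x | t < (centredMaximal G f x).toReal} * ENNReal.ofReal (t ^ (s - 1)) ≤
      ∑' y, 2 * C * ‖f y‖ₑ *
        (Set.Iio (2 * ‖f y‖)).indicator (fun t => ENNReal.ofReal (t ^ (s - 2))) t := by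
  classical
  let g : V → ℂ := fun y => if t < 2 * ‖f y‖ then f y else 0
  let l : ℝ≥0 := ⟨t / 2, by positivity⟩
  have hl : 0 < l := by
    rw [← NNReal.coe_pos]
    exact half_pos ht
  have hlt : (l : ℝ≥0∞) + l = ENNReal.ofReal t := by
    have : (l : ℝ≥0∞) = ENNReal.ofReal (t / 2) := (ENNReal.ofReal_eq_coe_nnreal _).symm
    rw [this, ← ENNReal.ofReal_add (by positivity) (by positivity), add_halves]
  have hfg : ∀ y, ‖f y‖ₑ ≤ ‖g y‖ₑ + l := by
    intro y
    by_cases h : t < 2 * ‖f y‖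
    · simp [g, h]
    · have hn : ‖f y‖₊ ≤ l := by
        rw [← NNReal.coe_le_coe, coe_nnnorm]
        change ‖f y‖ ≤ t / 2
        linarith
      simpa [g, h] using (ENNReal.coe_le_coe.2 hn : ‖f y‖ₑ ≤ l)
  have hsub : {x | t < (centredMaximal G f x).toReal} ⊆
      {x | (l : ℝ≥0∞) < centredMaximal G g x} := by
    intro x hx
    have h1 : ENNReal.ofReal t < centredMaximal G f x := by
      by_contra! h
      exact (not_le.2 hx) (ENNReal.toReal_le_of_le_ofReal ht.le h)
    have h2 := h1.trans_le (centredMaximal_le_add G hfg x)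
    rw [← hlt] at h2
    exact lt_of_add_lt_add_right h2
  have hcount : Measure.count {x | t < (centredMaximal G f x).toReal} ≤
      (l : ℝ≥0∞)⁻¹ * (C * ∑' y, ‖g y‖ₑ) := by
    refine (measure_mono hsub).trans ?_
    rw [mul_comm, ← div_eq_mul_inv, ENNReal.le_div_iff_mul_le (Or.inl (by simpa using hl.ne'))
      (Or.inl ENNReal.coe_ne_top), mul_comm]
    exact hC g l hl
  have hpow : (l : ℝ≥0∞)⁻¹ * ENNReal.ofReal (t ^ (s - 1)) = 2 * ENNReal.ofReal (t ^ (s - 2)) := by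
    have : (l : ℝ≥0∞) = ENNReal.ofReal (t / 2) := (ENNReal.ofReal_eq_coe_nnreal _).symm
    rw [this, ← ENNReal.ofReal_inv_of_pos (by positivity), ← ENNReal.ofReal_mul (by positivity),
      show (2 : ℝ≥0∞) = ENNReal.ofReal 2 by simp, ← ENNReal.ofReal_mul (by positivity)]
    congr 1
    rw [show s - 1 = s - 2 + 1 by ring, Real.rpow_add_one ht.ne']
    field_simp
  calc _ ≤ (l : ℝ≥0∞)⁻¹ * (C * ∑' y, ‖g y‖ₑ) * ENNReal.ofReal (t ^ (s - 1)) := by gcongr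
    _ = (2 * ENNReal.ofReal (t ^ (s - 2))) * C * ∑' y, ‖g y‖ₑ := by rw [← hpow]; ring
    _ = ∑' y, (2 * ENNReal.ofReal (t ^ (s - 2))) * C * ‖g y‖ₑ := ENNReal.tsum_mul_left.symm
    _ = _ := by
        refine tsum_congr fun y => ?_
        by_cases h : t < 2 * ‖f y‖
        · rw [Set.indicator_of_mem (by exact h)]
          simp only [g, h, if_true]
          ring
        · rw [Set.indicator_of_notMem (by exact h)]
          simp [g, h]

variable [DiscreteMeasurableSpace V]

theorem lintegral_centredMaximal_rpow_le [Countable V]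
    (hC : ∀ (f : V → ℂ) (l : ℝ≥0), 0 < l →
      l * Measure.count {x | (l : ℝ≥0∞) < centredMaximal G f x} ≤ C * ∑' y, ‖f y‖ₑ)
    {f : V → ℂ} (hf : ∀ x, centredMaximal G f x ≠ ∞) {s : ℝ} (hs : 1 < s) :
    ∫⁻ x, centredMaximal G f x ^ s ∂Measure.count ≤
      ENNReal.ofReal s * (2 * C * ENNReal.ofReal (2 ^ (s - 1) / (s - 1))) *
        ∫⁻ y, ‖f y‖ₑ ^ s ∂Measure.count := by
  have h1 : ∀ x, centredMaximal G f x ^ s =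
      ENNReal.ofReal ((centredMaximal G f x).toReal ^ s) := by
    intro x
    rw [← ENNReal.ofReal_rpow_of_nonneg ENNReal.toReal_nonneg (by linarith),
      ENNReal.ofReal_toReal (hf x)]
  simp_rw [h1]
  rw [lintegral_rpow_eq_lintegral_meas_lt_mul Measure.count
    (Filter.Eventually.of_forall fun _ => ENNReal.toReal_nonneg)
    (Measurable.of_discrete.aemeasurable) (by linarith), mul_assoc]
  gcongr
  have hmeas : ∀ r : ℝ, Measurable fun t : ℝ => ENNReal.ofReal (t ^ r) := fun r => by fun_prop
  calc _ ≤ ∫⁻ t in Set.Ioi (0 : ℝ), ∑' y, 2 * C * ‖f y‖ₑ *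
        (Set.Iio (2 * ‖f y‖)).indicator (fun t => ENNReal.ofReal (t ^ (s - 2))) t :=
        setLIntegral_mono' measurableSet_Ioi fun t ht =>
          count_lt_toReal_centredMaximal_mul_le hC f s ht
    _ = ∑' y, ∫⁻ t in Set.Ioi (0 : ℝ), 2 * C * ‖f y‖ₑ *
        (Set.Iio (2 * ‖f y‖)).indicator (fun t => ENNReal.ofReal (t ^ (s - 2))) t :=
        lintegral_tsum fun y =>
          (((hmeas _).indicator measurableSet_Iio).const_mul _).aemeasurable
    _ = ∑' y, 2 * C * ENNReal.ofReal (2 ^ (s - 1) / (s - 1)) * ‖f y‖ₑ ^ s := by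
        refine tsum_congr fun y => ?_
        rw [lintegral_const_mul _ ((hmeas _).indicator measurableSet_Iio),
          lintegral_indicator measurableSet_Iio, Measure.restrict_restrict measurableSet_Iio,
          Set.inter_comm, Set.Ioi_inter_Iio, lintegral_Ioo_rpow hs (by positivity)]
        rw [Real.mul_rpow (by norm_num) (norm_nonneg _), mul_div_right_comm,
          ENNReal.ofReal_mul (div_nonneg (by positivity) (by linarith)),
          ← ENNReal.ofReal_rpow_of_nonneg (norm_nonneg _) (by linarith), ofReal_norm]
        rw [show ‖f y‖ₑ ^ s = ‖f y‖ₑ * ‖f y‖ₑ ^ (s - 1) by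
          conv_lhs => rw [show s = 1 + (s - 1) by ring,
            ENNReal.rpow_add_of_nonneg _ _ zero_le_one (by linarith), ENNReal.rpow_one]]
        ring
    _ = _ := by rw [ENNReal.tsum_mul_left, lintegral_count]

theorem enorm_le_eLpNorm_count {p : ℝ≥0∞} (hp : p ≠ 0) (hp' : p ≠ ∞) (f : V → ℂ) (y : V) :
    ‖f y‖ₑ ≤ eLpNorm f p Measure.count := by
  have hs : 0 < p.toReal := ENNReal.toReal_pos hp hp'
  rw [eLpNorm_eq_lintegral_rpow_enorm_toReal hp hp', lintegral_count]
  calc ‖f y‖ₑ = (‖f y‖ₑ ^ p.toReal) ^ (1 / p.toReal) := by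
        rw [← ENNReal.rpow_mul, mul_one_div_cancel hs.ne', ENNReal.rpow_one]
    _ ≤ _ := ENNReal.rpow_le_rpow (ENNReal.le_tsum (f := fun y => ‖f y‖ₑ ^ p.toReal) y)
        (by positivity)

theorem centredMaximal_ne_top_of_memLp {p : ℝ≥0∞} (hp : p ≠ 0) (hp' : p ≠ ∞) {f : V → ℂ}
    (hf : MemLp f p Measure.count) (x : V) : centredMaximal G f x ≠ ∞ := by
  have h := centredMaximal_le_add G (g := 0) (t := eLpNorm f p Measure.count)
    (fun y => by simpa using enorm_le_eLpNorm_count hp hp' f y) x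
  have h0 : centredMaximal G 0 x = 0 := by simp [centredMaximal, ballAverage]
  rw [h0, zero_add] at h
  exact (h.trans_lt hf.eLpNorm_lt_top).ne

/-- Interpolation between the weak type `(1,1)` and the trivial bound on `L^∞`. -/
theorem boundedOnLp_centredMaximal [Countable V]
    (hC : ∀ (f : V → ℂ) (l : ℝ≥0), 0 < l →
      l * Measure.count {x | (l : ℝ≥0∞) < centredMaximal G f x} ≤ C * ∑' y, ‖f y‖ₑ)
    {p : ℝ≥0∞} (hp : 1 < p) (hp' : p ≠ ∞) : BoundedOnLp (centredMaximal G) p := by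
  have hp0 : p ≠ 0 := (zero_lt_one.trans hp).ne'
  have hs : 1 < p.toReal := by
    rw [← ENNReal.toReal_one]
    exact (ENNReal.toReal_lt_toReal ENNReal.one_ne_top hp').2 hp
  set s := p.toReal
  set K : ℝ≥0∞ := ENNReal.ofReal s * (2 * C * ENNReal.ofReal (2 ^ (s - 1) / (s - 1)))
  have hK : K ≠ ∞ := ENNReal.mul_ne_top ENNReal.ofReal_ne_top (ENNReal.mul_ne_top
    (ENNReal.mul_ne_top (by simp) ENNReal.coe_ne_top) ENNReal.ofReal_ne_top)
  have hs0 : 0 ≤ 1 / s := by positivity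
  refine ⟨(K ^ (1 / s)).toNNReal, fun f hf => ?_⟩
  rw [ENNReal.coe_toNNReal (ENNReal.rpow_ne_top_of_nonneg hs0 hK),
    eLpNorm_eq_lintegral_rpow_enorm_toReal hp0 hp', eLpNorm_eq_lintegral_rpow_enorm_toReal hp0 hp',
    ← ENNReal.mul_rpow_of_nonneg _ _ hs0]
  refine ENNReal.rpow_le_rpow ?_ hs0
  simpa only [enorm_eq_self] using
    lintegral_centredMaximal_rpow_le hC (centredMaximal_ne_top_of_memLp hp0 hp' hf) hs

end Interpolation

namespace GluedTree

variable {a b : ℕ}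

theorem count_desc_le_le {q : ℕ} (hq : 2 ≤ q) {R : Set (Vertex a b)}
    (hup : ∀ i z, Measure.count {x ∈ R | Desc i z x} ≤ (q : ℝ≥0∞) ^ i) (j : ℕ) (z : Vertex a b) :
    Measure.count {y ∈ R | ∃ k ≤ j, Desc k z y} ≤ 2 * (q : ℝ≥0∞) ^ j := by
  have hsub : {y ∈ R | ∃ k ≤ j, Desc k z y} ⊆
      ⋃ k ∈ Finset.range (j + 1), {y ∈ R | Desc k z y} := by
    rintro y ⟨hy, k, hk, h⟩
    exact Set.mem_biUnion (x := k) (by simpa [Nat.lt_succ_iff] using hk) ⟨hy, h⟩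
  calc _ ≤ ∑ k ∈ Finset.range (j + 1), Measure.count {y ∈ R | Desc k z y} :=
        (measure_mono hsub).trans (measure_biUnion_finset_le _ _)
    _ ≤ ∑ k ∈ Finset.range (j + 1), (q : ℝ≥0∞) ^ k := Finset.sum_le_sum fun k _ => hup k z
    _ ≤ _ := sum_range_pow_le hq j

theorem count_thinPart_inter_ball_le (ha : 2 ≤ a) (x : Vertex a b) (r : ℕ) :
    Measure.count (thinPart a b ∩ (graph a b).distClosedBall x r) ≤ 4 * (a : ℝ≥0∞) ^ r := by
  have h := lintegral_ball_le ((thinPart a b).indicator 1) x r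
    (g := fun i => 2 * (a : ℝ≥0∞) ^ (r - i)) fun i _ z _ => by
      rw [descSum, lintegral_indicator_one .of_discrete, Measure.restrict_apply .of_discrete]
      exact count_desc_le_le ha count_thinPart_desc_le (r - i) z
  rw [lintegral_indicator_one .of_discrete, Measure.restrict_apply .of_discrete] at h
  calc _ ≤ _ := h
    _ = 2 * ∑ i ∈ Finset.range (r + 1), (a : ℝ≥0∞) ^ i := by
        rw [← Finset.mul_sum, ← Finset.sum_range_reflect (fun i => (a : ℝ≥0∞) ^ i)]
        simp
    _ ≤ 2 * (2 * (a : ℝ≥0∞) ^ r) := by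
        gcongr
        exact sum_range_pow_le ha r
    _ = _ := by ring

theorem count_thickPart_inter_ball_le (hb : 2 ≤ b) {x : Vertex a b} (hx : x ∈ thinPart a b)
    (k : ℕ) : Measure.count (thickPart a b ∩ (graph a b).distClosedBall x (x.word.length + k)) ≤
      2 * (b : ℝ≥0∞) ^ k := by
  refine (measure_mono ?_).trans
    (count_desc_le_le hb (count_thickPart_desc_le (by omega)) k (root a b))
  rintro y ⟨hy, hball⟩
  obtain ⟨i, j, z, hij, hi, hj⟩ := exists_common_ancestor hball
  have hz : z = root a b := by
    by_contra hz
    exact mem_thinPart_of_desc hx hi (mem_thickPart_of_desc hy hj hz)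
  subst hz
  have := hi.length_word
  simp only [root, List.length_nil, add_zero] at this
  exact ⟨hy, j, by omega, hj⟩

theorem count_ball_le (ha : 2 ≤ a) (hb : 2 ≤ b) {x : Vertex a b} (hx : x ∈ thinPart a b) (k : ℕ) :
    Measure.count ((graph a b).distClosedBall x (x.word.length + k)) ≤
      4 * (a : ℝ≥0∞) ^ (x.word.length + k) + 2 * (b : ℝ≥0∞) ^ k := by
  rw [← Set.univ_inter ((graph a b).distClosedBall x _), ← thinPart_union_thickPart,
    Set.union_inter_distrib_right]
  exact (measure_union_le _ _).trans
    (add_le_add (count_thinPart_inter_ball_le ha x _) (count_thickPart_inter_ball_le hb hx k))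

/-- The vertex `[0]`. -/
def thickRoot (a b : ℕ) : Vertex a b := ⟨[0], by simp [numChildren], trivial⟩

theorem root_mem_thinPart : root a b ∈ thinPart a b := by simp [thinPart, root]

theorem thickRoot_mem_thickPart : thickRoot a b ∈ thickPart a b := by simp [thickPart, thickRoot]

/-- The vertices of the thick part at distance `m` from `[0]`. -/
def thickSphere (a b m : ℕ) : Set (Vertex a b) := {x ∈ thickPart a b | Desc m (thickRoot a b) x}

theorem count_thickSphere (hb : 1 ≤ b) (m : ℕ) :
    Measure.count (thickSphere a b m) = (b : ℝ≥0∞) ^ m :=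
  le_antisymm (count_thickPart_desc_le hb m _) (le_count_thickPart_desc m thickRoot_mem_thickPart)

theorem thickSphere_subset_ball (x : Vertex a b) (m : ℕ) :
    thickSphere a b m ⊆ (graph a b).distClosedBall x (x.word.length + (m + 1)) := by
  rintro y ⟨-, hy⟩
  have h1 : Desc 1 (root a b) (thickRoot a b) := desc_one.2 ⟨0, rfl⟩
  have h2 : Desc (m + 1) (root a b) y := by
    rw [add_comm]
    exact desc_add.2 ⟨_, h1, hy⟩
  calc (graph a b).dist x y ≤ (graph a b).dist x (root a b) + (graph a b).dist (root a b) y :=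
        (connected_graph a b).dist_triangle
    _ ≤ _ := by
        rw [SimpleGraph.dist_comm]
        exact add_le_add (desc_root x).dist_le h2.dist_le

theorem le_uncentredMaximal_thickSphere (ha : 2 ≤ a) (hab : a < b) {n m : ℕ}
    (hnm : a ^ (n + m) ≤ b ^ m) {x : Vertex a b}
    (hx : x ∈ {x ∈ thinPart a b | Desc (n + (n + (m + 1))) (root a b) x}) :
    (4 * a + 2 * b : ℝ≥0∞)⁻¹ ≤
      uncentredMaximal (graph a b) ((thickSphere a b m).indicator 1) x := by
  obtain ⟨hxt, hxd⟩ := hx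
  obtain ⟨z, hz, hzx⟩ := desc_add.1 hxd
  have hzt : z ∈ thinPart a b := mem_thinPart_of_desc hxt hzx
  have hzl : z.word.length = n := by simpa [root] using hz.length_word
  have hball : Measure.count ((graph a b).distClosedBall z (n + (m + 1))) ≤
      (4 * a + 2 * b) * (b : ℝ≥0∞) ^ m := by
    have h := count_ball_le ha (by omega) hzt (m + 1)
    rw [hzl] at h
    have hnm' : (a : ℝ≥0∞) ^ (n + m) ≤ (b : ℝ≥0∞) ^ m := by exact_mod_cast hnm
    calc _ ≤ _ := h
      _ = 4 * a * (a : ℝ≥0∞) ^ (n + m) + 2 * b * (b : ℝ≥0∞) ^ m := by ring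
      _ ≤ 4 * a * (b : ℝ≥0∞) ^ m + 2 * b * (b : ℝ≥0∞) ^ m := by gcongr
      _ = _ := by ring
  have hb0 : (b : ℝ≥0∞) ^ m ≠ 0 := pow_ne_zero _ (by simp; omega)
  have hbt : (b : ℝ≥0∞) ^ m ≠ ∞ := ENNReal.pow_ne_top (by simp)
  have havg : (4 * a + 2 * b : ℝ≥0∞)⁻¹ ≤
      ballAverage (graph a b) ((thickSphere a b m).indicator 1) z (n + (m + 1)) := by
    have hintegral : ∫⁻ y in (graph a b).distClosedBall z (n + (m + 1)),
        ‖(thickSphere a b m).indicator (1 : Vertex a b → ℂ) y‖ₑ ∂Measure.count =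
          (b : ℝ≥0∞) ^ m := by
      simp_rw [enorm_indicator_eq_indicator_enorm]
      simp only [Pi.one_apply, enorm_one]
      rw [lintegral_indicator_const .of_discrete, Measure.restrict_apply .of_discrete,
        Set.inter_eq_left.2, count_thickSphere (by omega), one_mul]
      simpa [hzl] using thickSphere_subset_ball z m
    rw [ballAverage, hintegral]
    calc (4 * a + 2 * b : ℝ≥0∞)⁻¹ = (b : ℝ≥0∞) ^ m / ((4 * a + 2 * b) * (b : ℝ≥0∞) ^ m) := by
          rw [mul_comm _ ((b : ℝ≥0∞) ^ m), div_eq_mul_inv, ENNReal.mul_inv (Or.inl hb0) (Or.inl hbt), ← mul_assoc,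
            ENNReal.mul_inv_cancel hb0 hbt, one_mul]
      _ ≤ _ := ENNReal.div_le_div_left hball _
  exact havg.trans (le_iSup_of_le z (le_iSup_of_le (n + (m + 1))
    (le_iSup_of_le hzx.dist_le le_rfl)))

theorem exists_pow_add_le_pow (ha : 2 ≤ a) (hab : a < b) (N : ℕ) :
    ∃ n m, N ≤ n ∧ a ^ (n + m) ≤ b ^ m ∧ b ^ m ≤ a ^ (n + (m + 1)) := by
  obtain ⟨m, hm⟩ : ∃ m, a ^ (N + m) ≤ b ^ m := by
    have h1 : (1 : ℝ) < b / a := by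
      rw [one_lt_div (by positivity)]
      exact_mod_cast hab
    obtain ⟨m, hm⟩ := pow_unbounded_of_one_lt ((a : ℝ) ^ N) h1
    refine ⟨m, ?_⟩
    rw [div_pow, lt_div_iff₀ (by positivity), ← pow_add] at hm
    exact_mod_cast hm.le
  have hb0 : b ^ m ≠ 0 := pow_ne_zero _ (by omega)
  have hlog : N + m ≤ Nat.log a (b ^ m) := Nat.le_log_of_pow_le (by omega) hm
  refine ⟨Nat.log a (b ^ m) - m, m, by omega, ?_, ?_⟩
  · rw [Nat.sub_add_cancel (by omega)]
    exact Nat.pow_log_le_self a hb0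
  · rw [show Nat.log a (b ^ m) - m + (m + 1) = (Nat.log a (b ^ m)).succ by omega]
    exact (Nat.lt_pow_succ_log_self (by omega) _).le

theorem not_boundedOnLp_uncentredMaximal (ha : 2 ≤ a) (hab : a < b) {p : ℝ≥0∞} (hp : p ≠ 0)
    (hp' : p ≠ ∞) : ¬ BoundedOnLp (uncentredMaximal (graph a b)) p := by
  rintro ⟨C, hC⟩
  have hs : 0 < p.toReal := ENNReal.toReal_pos hp hp'
  set s := p.toReal with hsdef
  set D : ℝ≥0∞ := 4 * a + 2 * b with hD
  have hD0 : D ≠ 0 := by simp [hD]; omega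
  have hDt : D ≠ ∞ := by simp [hD, ENNReal.mul_eq_top]
  have key : ∀ N : ℕ, (a : ℝ≥0∞) ^ N ≤ (C * D) ^ s := by
    intro N
    obtain ⟨n, m, hNn, h1, h2⟩ := exists_pow_add_le_pow ha hab N
    set f : Vertex a b → ℂ := (thickSphere a b m).indicator 1 with hf
    have hb0 : (b : ℝ≥0∞) ^ m ≠ 0 := pow_ne_zero _ (by simp; omega)
    have hbt : (b : ℝ≥0∞) ^ m ≠ ∞ := ENNReal.pow_ne_top (by simp)
    have hnorm : eLpNorm f p Measure.count = ((b : ℝ≥0∞) ^ m) ^ (1 / s) := by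
      have : f = (thickSphere a b m).indicator fun _ => (1 : ℂ) := rfl
      rw [this, eLpNorm_indicator_const .of_discrete hp hp', count_thickSphere (by omega)]
      simp [hsdef]
    have hmem : MemLp f p Measure.count := by
      refine ⟨Measurable.of_discrete.aestronglyMeasurable, ?_⟩
      rw [hnorm]
      exact ENNReal.rpow_lt_top_of_nonneg (by positivity) hbt
    have hbound := hC f hmem
    rw [hnorm, eLpNorm_eq_lintegral_rpow_enorm_toReal hp hp'] at hbound
    have hbound' := ENNReal.rpow_le_rpow hbound hs.le
    rw [ENNReal.mul_rpow_of_nonneg _ _ hs.le, ← ENNReal.rpow_mul, ← ENNReal.rpow_mul,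
      one_div_mul_cancel hs.ne', ENNReal.rpow_one, ENNReal.rpow_one] at hbound'
    simp only [enorm_eq_self] at hbound'
    set S : Set (Vertex a b) := {x ∈ thinPart a b | Desc (n + (n + (m + 1))) (root a b) x}
    have hlow : D⁻¹ ^ s * ((a : ℝ≥0∞) ^ n * (b : ℝ≥0∞) ^ m) ≤
        ∫⁻ x, uncentredMaximal (graph a b) f x ^ s ∂Measure.count :=
      calc _ ≤ D⁻¹ ^ s * Measure.count S := by
            gcongr
            refine le_trans ?_ (le_count_thinPart_desc _ root_mem_thinPart)
            rw [pow_add]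
            exact mul_le_mul_right (by exact_mod_cast h2) _
        _ = ∫⁻ _ in S, D⁻¹ ^ s ∂Measure.count := by rw [setLIntegral_const]
        _ ≤ ∫⁻ x in S, uncentredMaximal (graph a b) f x ^ s ∂Measure.count :=
            setLIntegral_mono' .of_discrete fun x hx => ENNReal.rpow_le_rpow
              (le_uncentredMaximal_thickSphere ha hab h1 hx) hs.le
        _ ≤ _ := setLIntegral_le_lintegral _ _
    have h3 := hlow.trans hbound'
    rw [← mul_assoc] at h3
    have h4 := (ENNReal.mul_le_mul_iff_left hb0 hbt).1 h3
    have hDs0 : D ^ s ≠ 0 := by simp [ENNReal.rpow_eq_zero_iff, hD0, hDt]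
    have hDst : D ^ s ≠ ∞ := ENNReal.rpow_ne_top_of_nonneg hs.le hDt
    calc (a : ℝ≥0∞) ^ N ≤ (a : ℝ≥0∞) ^ n := by
          gcongr
          exact_mod_cast (by omega : 1 ≤ a)
      _ = D ^ s * (D⁻¹ ^ s * (a : ℝ≥0∞) ^ n) := by
          rw [ENNReal.inv_rpow, ← mul_assoc, ENNReal.mul_inv_cancel hDs0 hDst, one_mul]
      _ ≤ D ^ s * (C : ℝ≥0∞) ^ s := by gcongr
      _ = (C * D) ^ s := by rw [ENNReal.mul_rpow_of_nonneg _ _ hs.le, mul_comm]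
  have hfin : (C * D) ^ s ≠ ∞ :=
    ENNReal.rpow_ne_top_of_nonneg hs.le (ENNReal.mul_ne_top ENNReal.coe_ne_top hDt)
  obtain ⟨N, hN⟩ := ENNReal.exists_nat_gt hfin
  refine absurd (key N) (not_le.2 (hN.trans_le ?_))
  exact_mod_cast (Nat.lt_pow_self (by omega : 1 < a)).le

end GluedTree

theorem theorem4p1 (a b : ℕ) (ha : 2 ≤ a) (hab : a < b) :
    (∀ p : ℝ≥0∞, 1 ≤ p → p ≠ ∞ →
      ¬ BoundedOnLp (uncentredMaximal (GluedTree.graph a b)) p) ∧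
    (∀ p : ℝ≥0∞, 1 < p → p ≠ ∞ →
      BoundedOnLp (centredMaximal (GluedTree.graph a b)) p) ∧
    WeakTypeOneOne (centredMaximal (GluedTree.graph a b)) := by
  obtain ⟨C, hC⟩ := GluedTree.exists_mul_count_le (a := a) (b := b) ha (by omega)
  refine ⟨fun p hp hp' => GluedTree.not_boundedOnLp_uncentredMaximal ha hab
    (zero_lt_one.trans_le hp).ne' hp', fun p hp hp' => boundedOnLp_centredMaximal hC hp hp',
    C, fun f _ l hl => ?_⟩
  rw [eLpNorm_one_eq_lintegral_enorm, lintegral_count]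
  exact hC f l hl
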